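/- Let $n\ge 0$ and $0<\xi<1/2$. Alice receives $x\in\mathbb{R}^n$ and Bob receives $y\in\mathbb{R}^n$. Under $\mu_{\mathrm{yes}}$ the pairs $(x_i,y_i)$, $1\le i\le n$, are independent, each a pair of standard normal variables that are jointly Gaussian with correlation $\xi$; under $\mu_{\mathrm{no}}$ the pairs $(x_i,y_i)$ are independent, each a pair of independent standard normal variables. A $k$-bit two-way protocol with shared randomness is a family of deterministic two-party protocol trees, indexed by a random string $\omega$ that is independent of the inputs and seen by both players, in each of which at most $k$ bits are exchanged on every path: at each inner node one of the players sends a bit depending on their own input (and $\omega$), and each leaf is labelled with an output in $\{0,1\}$; the output is a measurable function of $(x,y,\omega)$. Its advantage in distinguishing $\mu_{\mathrm{yes}}$ from $\mu_{\mathrm{no}}$ is $\bigl|\Pr_{(x,y)\sim\mu_{\mathrm{yes}},\,\omega}[\text{output}=1]-\Pr_{(x,y)\sim\mu_{\mathrm{no}},\,\omega}[\text{output}=1]\bigr|$. Then for every $\gamma>0$ there is a constant $c=c(\gamma)>0$ such that for all $\xi\in(0,1/2)$, all $n$ and all $k$: if some $k$-bit two-way protocol with shared randomness distinguishes $\mu_{\mathrm{yes}}$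 from $\mu_{\mathrm{no}}$ with advantage at least $\gamma$, then $k\ge c/\xi$. -/

import Mathlib

open MeasureTheory ProbabilityTheory

/-- A deterministic two-party protocol tree: Alice holds an input in `X`, Bob one in `Y`. At an
inner node the named player sends one bit computed from their own input, and the protocol moves to
the child selected by that bit; a leaf carries the Boolean output. -/
inductive ProtocolTree (X Y : Type*) where
  | output (b : Bool) : ProtocolTree X Y
  | alice (msg : X → Bool) (next : Bool → ProtocolTree X Y) : ProtocolTree X Y
  | bob (msg : Y → Bool) (next : Bool → ProtocolTree X Y) : ProtocolTree X Y

namespace ProtocolTree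

variable {X Y : Type*}

/-- The output of the protocol on the input pair `(x, y)`. -/
def run : ProtocolTree X Y → X → Y → Bool
  | output b, _, _ => b
  | alice msg next, x, y => (next (msg x)).run x y
  | bob msg next, x, y => (next (msg y)).run x y

/-- The largest number of bits exchanged on any root-to-leaf path. -/
def depth : ProtocolTree X Y → ℕ
  | output _ => 0
  | alice _ next => max (next false).depth (next true).depth + 1
  | bob _ next => max (next false).depth (next true).depth + 1

end ProtocolTree

/-- A `k`-bit two-way protocol with shared randomness: for each value `ω` of the random string, seen
by both players, a deterministic protocol exchanging at most `k` bits; the output is a measurable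
function of inputs and random string. Private coins are the special case in which each player reads
only a part of `ω`. -/
structure SharedRandomnessProtocol (X Y Ω : Type*) [MeasurableSpace X] [MeasurableSpace Y]
    [MeasurableSpace Ω] (k : ℕ) where
  tree : Ω → ProtocolTree X Y
  depth_le : ∀ ω, (tree ω).depth ≤ k
  measurable_run : Measurable fun z : (X × Y) × Ω => (tree z.2).run z.1.1 z.1.2

namespace SharedRandomnessProtocol

variable {X Y Ω : Type*} [MeasurableSpace X] [MeasurableSpace Y] [MeasurableSpace Ω] {k : ℕ}

/-- The probability that the protocol outputs `true` when the input pair has law `μ` and the shared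
random string is drawn independently with law `P`. -/
noncomputable def acceptProb (Q : SharedRandomnessProtocol X Y Ω k) (P : Measure Ω)
    (μ : Measure (X × Y)) : ℝ :=
  (μ.prod P).real {z | (Q.tree z.2).run z.1.1 z.1.2 = true}

/-- The advantage with which the protocol distinguishes the input laws `μ` and `ν`. -/
noncomputable def advantage (Q : SharedRandomnessProtocol X Y Ω k) (P : Measure Ω)
    (μ ν : Measure (X × Y)) : ℝ :=
  |Q.acceptProb P μ - Q.acceptProb P ν|

end SharedRandomnessProtocol

/-- The law of a pair of `ρ`-correlated standard normal variables (for `|ρ| ≤ 1`): the centred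
bivariate normal law with unit variances and covariance `ρ`. -/
noncomputable def gaussianPair (ρ : ℝ) : Measure (ℝ × ℝ) :=
  (multivariateGaussian (0 : EuclideanSpace ℝ (Fin 2)) !![1, ρ; ρ, 1]).map fun z => (z 0, z 1)

/-- The law of `(x, y)` with `x, y ∈ ℝⁿ`, where the pairs `(x i, y i)` are independent and each has
law `gaussianPair ρ`. -/
noncomputable def gaussianInputs (n : ℕ) (ρ : ℝ) : Measure ((Fin n → ℝ) × (Fin n → ℝ)) :=
  (Measure.pi fun _ : Fin n => gaussianPair ρ).map fun z => (fun i => (z i).1, fun i => (z i).2)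

/-! A `k`-bit protocol tree splits the input space into at most `2 ^ k` rectangles, so everything
rests on comparing the two input laws on a rectangle. The comparison is two-function
hypercontractivity: for `ξ`-correlated Gaussians, `E[f(x) g(y)] ≤ ‖f‖_p ‖g‖_p` with `p = 1 + ξ`. On
indicators it reads `μ_yes(A × B) ≤ μ_no(A × B) ^ s` with `s = 1 / (1 + ξ)`, because both laws have
the same marginals (`gaussianInputs_prod_le`).

Summing over leaves, concavity of `t ↦ t ^ s` costs a factor `2 ^ (1 - s)` per bit, so each output
has `Pr_yes ≤ 2 ^ ((1 - s) k) * Pr_no ^ s` (`ProtocolTree.measure_run_le`). Since `1 - s ≤ ξ`, this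
gives `Pr_yes - Pr_no ≤ 3 k ξ` when `k ξ ≤ 1`; using both outputs bounds the absolute difference,
and averaging over `ω` bounds the advantage.

Hypercontractivity is proved first for one pair of correlated signs (`twoPoint_inequality`). It
tensorizes, survives pushing each side forward separately, and is closed under weak limits, so the
central limit theorem carries it to a Gaussian pair; tensorizing again gives `n` pairs. -/

open Filter Topology
open scoped ENNReal NNReal BoundedContinuousFunction

/-! ### Two-function hypercontractivity -/

/-- `E[f(x) g(y)] ≤ ‖f‖_p ‖g‖_p` for all measurable `f, g` with values in `[0, 1]`, where the pair
`(x, y)` has law `ν`. -/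
def TwoFunctionHypercontractive {X Y : Type*} [MeasurableSpace X] [MeasurableSpace Y] (p : ℝ)
    (ν : Measure (X × Y)) : Prop :=
  ∀ (f : X → ℝ≥0∞) (g : Y → ℝ≥0∞), Measurable f → Measurable g → (∀ x, f x ≤ 1) → (∀ y, g y ≤ 1) →
    ∫⁻ z, f z.1 * g z.2 ∂ν ≤ (∫⁻ z, f z.1 ^ p ∂ν) ^ (1 / p) * (∫⁻ z, g z.2 ^ p ∂ν) ^ (1 / p)

namespace TwoFunctionHypercontractive

variable {X Y X' Y' : Type*} [MeasurableSpace X] [MeasurableSpace Y] [MeasurableSpace X']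
  [MeasurableSpace Y'] {p : ℝ} {ν : Measure (X × Y)}

theorem map (h : TwoFunctionHypercontractive p ν) {φ : X → X'} {ψ : Y → Y'} (hφ : Measurable φ)
    (hψ : Measurable ψ) : TwoFunctionHypercontractive p (ν.map (Prod.map φ ψ)) := by
  intro f g hf hg hf1 hg1
  rw [lintegral_map (by fun_prop) (by fun_prop), lintegral_map (by fun_prop) (by fun_prop),
    lintegral_map (by fun_prop) (by fun_prop)]
  exact h (f ∘ φ) (g ∘ ψ) (hf.comp hφ) (hg.comp hψ) (fun x => hf1 _) (fun y => hg1 _)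

theorem measure_prod_le (h : TwoFunctionHypercontractive p ν) (hp : 0 < p) {A : Set X} {B : Set Y}
    (hA : MeasurableSet A) (hB : MeasurableSet B) :
    ν (A ×ˢ B) ≤ (ν.map Prod.fst A * ν.map Prod.snd B) ^ (1 / p) := by
  have key := h (A.indicator 1) (B.indicator 1) (measurable_one.indicator hA)
    (measurable_one.indicator hB) (fun x => Set.indicator_le_self' (by simp) x)
    (fun x => Set.indicator_le_self' (by simp) x)
  have e1 : ∀ z : X × Y, A.indicator (1 : X → ℝ≥0∞) z.1 * B.indicator (1 : Y → ℝ≥0∞) z.2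
      = (A ×ˢ B).indicator 1 z := by
    intro z
    by_cases h1 : z.1 ∈ A <;> by_cases h2 : z.2 ∈ B <;> simp [h1, h2, Set.mem_prod]
  have e2 : ∀ z : X × Y, A.indicator (1 : X → ℝ≥0∞) z.1 ^ p = (Prod.fst ⁻¹' A).indicator 1 z := by
    intro z
    by_cases h1 : z.1 ∈ A <;> simp [h1, hp]
  have e3 : ∀ z : X × Y, B.indicator (1 : Y → ℝ≥0∞) z.2 ^ p = (Prod.snd ⁻¹' B).indicator 1 z := by
    intro z
    by_cases h1 : z.2 ∈ B <;> simp [h1, hp]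
  simp_rw [e1, e2, e3] at key
  rw [lintegral_indicator_one (hA.prod hB), lintegral_indicator_one (measurable_fst hA),
    lintegral_indicator_one (measurable_snd hB)] at key
  rwa [Measure.map_apply measurable_fst hA, Measure.map_apply measurable_snd hB,
    ENNReal.mul_rpow_of_nonneg _ _ (by positivity)]

end TwoFunctionHypercontractive

theorem lintegral_pi_fin_succ {Z : Type*} [MeasurableSpace Z] (ν : Measure Z) [SigmaFinite ν]
    {n : ℕ} {F : (Fin (n + 1) → Z) → ℝ≥0∞} (hF : Measurable F) :
    ∫⁻ z, F z ∂(Measure.pi fun _ => ν) =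
      ∫⁻ a, ∫⁻ z, F (Fin.cons a z) ∂(Measure.pi fun _ : Fin n => ν) ∂ν := by
  have h := measurePreserving_piFinSuccAbove (fun _ : Fin (n + 1) => ν) 0
  have hs := h.symm
  rw [← hs.lintegral_comp hF, lintegral_prod]
  · simp [MeasurableEquiv.piFinSuccAbove, Fin.insertNthEquiv, Fin.insertNth_zero']
  · exact (hF.comp (MeasurableEquiv.measurable _)).aemeasurable

namespace TwoFunctionHypercontractive

variable {X Y : Type*} [MeasurableSpace X] [MeasurableSpace Y] {p : ℝ} {ν : Measure (X × Y)}

/-- Tensorization. -/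
theorem pi [IsProbabilityMeasure ν] (h : TwoFunctionHypercontractive p ν) (hp : 0 < p) (n : ℕ) :
    TwoFunctionHypercontractive p ((Measure.pi fun _ : Fin n => ν).map
      fun z => ((fun i => (z i).1, fun i => (z i).2) : (Fin n → X) × (Fin n → Y))) := by
  induction n with
  | zero =>
    intro f g hf hg hf1 hg1
    rw [lintegral_map (by fun_prop) (by fun_prop), lintegral_map (by fun_prop) (by fun_prop),
      lintegral_map (by fun_prop) (by fun_prop)]
    simp only [fun z : Fin 0 → X × Y => Subsingleton.elim (fun i => (z i).1) (fun i => i.elim0),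
      fun z : Fin 0 → X × Y => Subsingleton.elim (fun i => (z i).2) (fun i => i.elim0),
      lintegral_const, measure_univ, mul_one]
    rw [← ENNReal.rpow_mul, ← ENNReal.rpow_mul, mul_one_div_cancel hp.ne', ENNReal.rpow_one,
      ENNReal.rpow_one]
  | succ n ih =>
    intro f g hf hg hf1 hg1
    rw [lintegral_map (by fun_prop) (by fun_prop), lintegral_map (by fun_prop) (by fun_prop),
      lintegral_map (by fun_prop) (by fun_prop)]
    rw [lintegral_pi_fin_succ ν (by fun_prop), lintegral_pi_fin_succ ν (by fun_prop),
      lintegral_pi_fin_succ ν (by fun_prop)]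
    have c1 : ∀ (a : X × Y) (z : Fin n → X × Y),
        (fun i => (Fin.cons (α := fun _ => X × Y) a z i).1) =
          Fin.cons (α := fun _ => X) a.1 (fun i => (z i).1) := by
      intro a z; funext i; refine Fin.cases ?_ (fun j => ?_) i <;> simp
    have c2 : ∀ (a : X × Y) (z : Fin n → X × Y),
        (fun i => (Fin.cons (α := fun _ => X × Y) a z i).2) =
          Fin.cons (α := fun _ => Y) a.2 (fun i => (z i).2) := by
      intro a z; funext i; refine Fin.cases ?_ (fun j => ?_) i <;> simp
    simp only [c1, c2]
    have mc1 : Measurable fun q : X × (Fin n → X) => Fin.cons (α := fun _ => X) q.1 q.2 := by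
      refine measurable_pi_lambda _ fun i => ?_
      refine Fin.cases ?_ (fun j => ?_) i <;> simp <;> fun_prop
    have mc2 : Measurable fun q : Y × (Fin n → Y) => Fin.cons (α := fun _ => Y) q.1 q.2 := by
      refine measurable_pi_lambda _ fun i => ?_
      refine Fin.cases ?_ (fun j => ?_) i <;> simp <;> fun_prop
    set π : Measure (Fin n → X × Y) := Measure.pi fun _ : Fin n => ν with hπ
    -- `F` and `G` are the `L^p` norms in the last `n` coordinates with the first one frozen. The
    -- induction hypothesis bounds the inner integral by `F a.1 * G a.2`, and the one-pair
    -- inequality applied to `F, G` finishes, since the `L^p` norm of `F` is that of `f`.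
    let F : X → ℝ≥0∞ := fun a =>
      (∫⁻ z, f (Fin.cons (α := fun _ => X) a (fun i => (z i).1)) ^ p ∂π) ^ (1 / p)
    let G : Y → ℝ≥0∞ := fun a =>
      (∫⁻ z, g (Fin.cons (α := fun _ => Y) a (fun i => (z i).2)) ^ p ∂π) ^ (1 / p)
    have mF : Measurable F := by
      refine Measurable.pow_const (Measurable.lintegral_prod_right ?_) _
      exact (hf.comp (mc1.comp (f := fun q : X × (Fin n → X × Y) => (q.1, fun i => (q.2 i).1))
        (by fun_prop))).pow_const p
    have mG : Measurable G := by
      refine Measurable.pow_const (Measurable.lintegral_prod_right ?_) _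
      exact (hg.comp (mc2.comp (f := fun q : Y × (Fin n → X × Y) => (q.1, fun i => (q.2 i).2))
        (by fun_prop))).pow_const p
    have F1 : ∀ a, F a ≤ 1 := fun a => by
      refine ENNReal.rpow_le_one ?_ (by positivity)
      calc _ ≤ ∫⁻ z, 1 ∂π := lintegral_mono fun z => ENNReal.rpow_le_one (hf1 _) hp.le
        _ = 1 := by simp [hπ]
    have G1 : ∀ a, G a ≤ 1 := fun a => by
      refine ENNReal.rpow_le_one ?_ (by positivity)
      calc _ ≤ ∫⁻ z, 1 ∂π := lintegral_mono fun z => ENNReal.rpow_le_one (hg1 _) hp.le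
        _ = 1 := by simp [hπ]
    calc _ ≤ ∫⁻ a, F a.1 * G a.2 ∂ν := by
          refine lintegral_mono fun a => ?_
          have hfa : Measurable fun x : Fin n → X => f (Fin.cons (α := fun _ => X) a.1 x) :=
            hf.comp (mc1.comp measurable_prodMk_left)
          have hga : Measurable fun x : Fin n → Y => g (Fin.cons (α := fun _ => Y) a.2 x) :=
            hg.comp (mc2.comp measurable_prodMk_left)
          have := ih (fun x => f (Fin.cons (α := fun _ => X) a.1 x))
            (fun y => g (Fin.cons (α := fun _ => Y) a.2 y)) hfa hga (fun _ => hf1 _) (fun _ => hg1 _)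
          rwa [lintegral_map (by fun_prop) (by fun_prop), lintegral_map (by fun_prop) (by fun_prop),
            lintegral_map (by fun_prop) (by fun_prop)] at this
      _ ≤ _ := h F G mF mG F1 G1
      _ = _ := by
          simp only [F, G, ← ENNReal.rpow_mul, one_div, inv_mul_cancel₀ hp.ne', ENNReal.rpow_one]

end TwoFunctionHypercontractive

/-! ### The two-point inequality -/

/-- AM-GM: the product of the two terms is `(1 - u ^ 2) ^ (-r) ≥ 1`. -/
theorem two_le_rpow_add_rpow {r u : ℝ} (hr : 0 ≤ r) (hu0 : 0 ≤ u) (hu1 : u < 1) :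
    2 ≤ (1 + u) ^ (-r) + (1 - u) ^ (-r) := by
  have h1 : 0 < (1 + u) ^ (-r) := Real.rpow_pos_of_pos (by linarith) _
  have h2 : 0 < (1 - u) ^ (-r) := Real.rpow_pos_of_pos (by linarith) _
  have h3 : 1 ≤ (1 + u) ^ (-r) * (1 - u) ^ (-r) := by
    rw [← Real.mul_rpow (by linarith) (by linarith)]
    exact Real.one_le_rpow_of_pos_of_le_one_of_nonpos (by nlinarith) (by nlinarith) (by linarith)
  nlinarith [sq_nonneg ((1 + u) ^ (-r) - (1 - u) ^ (-r))]

/-- Both sides vanish at `u = 0`, and the difference of their derivatives is nonnegative by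
`two_le_rpow_add_rpow` with `r = 1 - q`. -/
theorem two_mul_le_rpow_sub_rpow {q u : ℝ} (hq0 : 0 < q) (hq1 : q ≤ 1) (hu0 : 0 ≤ u)
    (hu1 : u ≤ 1) : 2 * q * u ≤ (1 + u) ^ q - (1 - u) ^ q := by
  have hmono : MonotoneOn (fun u : ℝ => (1 + u) ^ q - (1 - u) ^ q - 2 * q * u) (Set.Icc 0 1) := by
    have hd : ∀ x ∈ Set.Ioo (0 : ℝ) 1, HasDerivAt
        (fun u : ℝ => (1 + u) ^ q - (1 - u) ^ q - 2 * q * u)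
        (1 * q * (1 + x) ^ (q - 1) - -1 * q * (1 - x) ^ (q - 1) - 2 * q) x := by
      intro x hx
      refine HasDerivAt.sub (HasDerivAt.sub ?_ ?_) ?_
      · exact ((hasDerivAt_id x).const_add 1).rpow_const (Or.inl (by simp; linarith [hx.1]))
      · exact ((hasDerivAt_id x).const_sub 1).rpow_const (Or.inl (by simp; linarith [hx.2]))
      · simpa using (hasDerivAt_id x).const_mul (2 * q)
    refine monotoneOn_of_deriv_nonneg (convex_Icc 0 1) ?_ ?_ ?_
    · refine ContinuousOn.sub (ContinuousOn.sub ?_ ?_) (by fun_prop)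
      · exact ContinuousOn.rpow_const (by fun_prop) (fun _ _ => Or.inr hq0.le)
      · exact ContinuousOn.rpow_const (by fun_prop) (fun _ _ => Or.inr hq0.le)
    · rw [interior_Icc]
      exact fun x hx => (hd x hx).differentiableAt.differentiableWithinAt
    · rw [interior_Icc]
      intro x hx
      rw [(hd x hx).deriv]
      have := two_le_rpow_add_rpow (r := 1 - q) (u := x) (by linarith) hx.1.le hx.2
      rw [neg_sub] at this
      nlinarith
  have := hmono (Set.left_mem_Icc.2 zero_le_one) ⟨hu0, hu1⟩ hu0
  simp at this
  linarith

/-- A second integration: the derivative of the difference is `1 + q` times the gap in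
`two_mul_le_rpow_sub_rpow`. -/
theorem one_add_sq_le_rpow_add_rpow {q u : ℝ} (hq0 : 0 < q) (hq1 : q ≤ 1) (hu0 : 0 ≤ u)
    (hu1 : u ≤ 1) :
    2 + (1 + q) * q * u ^ 2 ≤ (1 + u) ^ (1 + q) + (1 - u) ^ (1 + q) := by
  have hmono : MonotoneOn (fun u : ℝ => (1 + u) ^ (1 + q) + (1 - u) ^ (1 + q)
      - (1 + q) * q * u ^ 2) (Set.Icc 0 1) := by
    have hd : ∀ x ∈ Set.Ioo (0 : ℝ) 1, HasDerivAt
        (fun u : ℝ => (1 + u) ^ (1 + q) + (1 - u) ^ (1 + q) - (1 + q) * q * u ^ 2)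
        (1 * (1 + q) * (1 + x) ^ (1 + q - 1) + -1 * (1 + q) * (1 - x) ^ (1 + q - 1)
          - (1 + q) * q * (2 * x)) x := by
      intro x hx
      refine HasDerivAt.sub (HasDerivAt.add ?_ ?_) ?_
      · exact ((hasDerivAt_id x).const_add 1).rpow_const (Or.inl (by simp; linarith [hx.1]))
      · exact ((hasDerivAt_id x).const_sub 1).rpow_const (Or.inl (by simp; linarith [hx.2]))
      · simpa using (hasDerivAt_pow 2 x).const_mul ((1 + q) * q)
    refine monotoneOn_of_deriv_nonneg (convex_Icc 0 1) ?_ ?_ ?_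
    · refine ContinuousOn.sub (ContinuousOn.add ?_ ?_) (by fun_prop)
      · exact ContinuousOn.rpow_const (by fun_prop) (fun _ _ => Or.inr (by linarith))
      · exact ContinuousOn.rpow_const (by fun_prop) (fun _ _ => Or.inr (by linarith))
    · rw [interior_Icc]
      exact fun x hx => (hd x hx).differentiableAt.differentiableWithinAt
    · rw [interior_Icc]
      intro x hx
      rw [(hd x hx).deriv]
      have := two_mul_le_rpow_sub_rpow hq0 hq1 hx.1.le hx.2.le
      rw [add_sub_cancel_left]
      nlinarith
  have := hmono (Set.left_mem_Icc.2 zero_le_one) ⟨hu0, hu1⟩ hu0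
  simp at this
  linarith

/-- Bernoulli with exponent `(1 + q) / 2 ≤ 1` bounds the left side by `1 + (1 + q) q u ^ 2 / 2`;
evenness in `u` then reduces to the bound on `[0, 1]`. -/
theorem one_add_sq_rpow_le {q u : ℝ} (hq0 : 0 < q) (hq1 : q ≤ 1) (hu : |u| ≤ 1) :
    (1 + q * u ^ 2) ^ ((1 + q) / 2) ≤ ((1 + u) ^ (1 + q) + (1 - u) ^ (1 + q)) / 2 := by
  have h1 := one_add_sq_le_rpow_add_rpow hq0 hq1 (abs_nonneg u) hu
  have h2 : (1 + |u|) ^ (1 + q) + (1 - |u|) ^ (1 + q) = (1 + u) ^ (1 + q) + (1 - u) ^ (1 + q) := by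
    rcases abs_choice u with h | h <;> rw [h]
    rw [sub_neg_eq_add, ← sub_eq_add_neg, add_comm]
  rw [h2, sq_abs] at h1
  have h3 := rpow_one_add_le_one_add_mul_self (s := q * u ^ 2) (p := (1 + q) / 2)
    (by nlinarith [mul_nonneg hq0.le (sq_nonneg u)]) (by linarith) (by linarith)
  nlinarith

/-- The quadratic form of mean `(a + b) / 2` and half-difference `(a - b) / 2` is dominated by the
`L^{1+q}` norm of the function with values `a, b` on two points. -/
theorem sqrt_le_twoPoint_norm {q a b : ℝ} (hq0 : 0 < q) (hq1 : q ≤ 1) (ha : 0 ≤ a) (hb : 0 ≤ b) :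
    √(((a + b) / 2) ^ 2 + q * ((a - b) / 2) ^ 2) ≤
      ((a ^ (1 + q) + b ^ (1 + q)) / 2) ^ (1 / (1 + q)) := by
  rcases eq_or_lt_of_le (add_nonneg ha hb) with h0 | h0
  · have : a = 0 := by linarith
    have : b = 0 := by linarith
    subst_vars
    simp
    positivity
  -- By homogeneity the mean `m` factors out, leaving the values `1 + u` and `1 - u`.
  set m := (a + b) / 2 with hm
  set u := (a - b) / (a + b) with hu
  have hm0 : 0 < m := by positivity
  have ea : a = m * (1 + u) := by rw [hm, hu]; field_simp; ring
  have eb : b = m * (1 - u) := by rw [hm, hu]; field_simp; ring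
  have hu1 : |u| ≤ 1 := by
    rw [hu, abs_div, abs_of_pos h0, div_le_one h0, abs_le]; constructor <;> linarith
  have e1 : m ^ 2 + q * ((a - b) / 2) ^ 2 = m ^ 2 * (1 + q * u ^ 2) := by
    rw [show (a - b) / 2 = m * u by rw [hm, hu]; field_simp]; ring
  have hn : 0 ≤ 1 + q * u ^ 2 := by positivity
  have hu1' := abs_le.1 hu1
  have key := one_add_sq_rpow_le hq0 hq1 hu1
  have hr := Real.rpow_le_rpow (by positivity) key (z := 1 / (1 + q)) (by positivity)
  rw [← Real.rpow_mul hn, show (1 + q) / 2 * (1 / (1 + q)) = 1 / 2 by field_simp,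
    ← Real.sqrt_eq_rpow] at hr
  have e2 : (a ^ (1 + q) + b ^ (1 + q)) / 2 =
      m ^ (1 + q) * (((1 + u) ^ (1 + q) + (1 - u) ^ (1 + q)) / 2) := by
    nth_rewrite 1 [ea]
    nth_rewrite 1 [eb]
    rw [Real.mul_rpow hm0.le (by linarith), Real.mul_rpow hm0.le (by linarith)]
    ring
  rw [e1, Real.sqrt_mul (by positivity), Real.sqrt_sq hm0.le, e2,
    Real.mul_rpow (by positivity) (by
      have := Real.rpow_nonneg (show 0 ≤ 1 + u by linarith) (1 + q)
      have := Real.rpow_nonneg (show 0 ≤ 1 - u by linarith) (1 + q)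
      positivity), ← Real.rpow_mul hm0.le, mul_one_div_cancel (by positivity), Real.rpow_one]
  gcongr

/-- The left side is the product of the means plus `q` times the product of the half-differences.
Cauchy–Schwarz for this form reduces it to `sqrt_le_twoPoint_norm` for each function; the square
passed to `nlinarith` is Lagrange's identity. -/
theorem twoPoint_inequality {q a b c d : ℝ} (hq0 : 0 < q) (hq1 : q ≤ 1) (ha : 0 ≤ a) (hb : 0 ≤ b)
    (hc : 0 ≤ c) (hd : 0 ≤ d) :
    (1 + q) / 4 * (a * c + b * d) + (1 - q) / 4 * (a * d + b * c) ≤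
      ((a ^ (1 + q) + b ^ (1 + q)) / 2) ^ (1 / (1 + q)) *
        ((c ^ (1 + q) + d ^ (1 + q)) / 2) ^ (1 / (1 + q)) := by
  refine le_trans ?_ (mul_le_mul (sqrt_le_twoPoint_norm hq0 hq1 ha hb)
    (sqrt_le_twoPoint_norm hq0 hq1 hc hd) (by positivity) (by positivity))
  rw [← Real.sqrt_mul (by positivity)]
  apply Real.le_sqrt_of_sq_le
  nlinarith [mul_nonneg hq0.le (sq_nonneg ((a + b) * (c - d) - (a - b) * (c + d)))]

/-! ### Correlated signs -/

/-- The law of a pair of uniform random signs with correlation `ξ`. -/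
noncomputable def signPair (ξ : ℝ) : Measure (ℝ × ℝ) :=
  ENNReal.ofReal ((1 + ξ) / 4) • (Measure.dirac (1, 1) + Measure.dirac (-1, -1)) +
    ENNReal.ofReal ((1 - ξ) / 4) • (Measure.dirac (1, -1) + Measure.dirac (-1, 1))

theorem lintegral_signPair (ξ : ℝ) (F : ℝ × ℝ → ℝ≥0∞) :
    ∫⁻ z, F z ∂(signPair ξ) = ENNReal.ofReal ((1 + ξ) / 4) * (F (1, 1) + F (-1, -1)) +
      ENNReal.ofReal ((1 - ξ) / 4) * (F (1, -1) + F (-1, 1)) := by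
  simp [signPair, lintegral_add_measure, lintegral_smul_measure, mul_add]

theorem isProbabilityMeasure_signPair {ξ : ℝ} (h1 : -1 ≤ ξ) (h2 : ξ ≤ 1) :
    IsProbabilityMeasure (signPair ξ) := by
  constructor
  rw [← lintegral_one, lintegral_signPair, show (1 : ℝ≥0∞) + 1 = ENNReal.ofReal 2 by norm_num,
    ← ENNReal.ofReal_mul (by linarith), ← ENNReal.ofReal_mul (by linarith),
    ← ENNReal.ofReal_add (by nlinarith) (by nlinarith), ← ENNReal.ofReal_one]
  congr 1
  ring

theorem integral_signPair {ξ : ℝ} (h1 : -1 ≤ ξ) (h2 : ξ ≤ 1) (F : ℝ × ℝ → ℝ) :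
    ∫ z, F z ∂(signPair ξ) =
      (1 + ξ) / 4 * (F (1, 1) + F (-1, -1)) + (1 - ξ) / 4 * (F (1, -1) + F (-1, 1)) := by
  have hi : ∀ x, Integrable F (Measure.dirac x) := fun x => integrable_dirac (by simp)
  have hs : ∀ (r : ℝ) x y, Integrable F (ENNReal.ofReal r • (Measure.dirac x + Measure.dirac y)) :=
    fun r x y => ((hi x).add_measure (hi y)).smul_measure ENNReal.ofReal_ne_top
  rw [signPair, integral_add_measure (hs _ _ _) (hs _ _ _), integral_smul_measure,
    integral_smul_measure, integral_add_measure (hi _) (hi _), integral_add_measure (hi _) (hi _)]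
  simp only [integral_dirac, smul_eq_mul]
  rw [ENNReal.toReal_ofReal (by linarith), ENNReal.toReal_ofReal (by linarith)]

theorem twoFunctionHypercontractive_signPair {ξ : ℝ} (h0 : 0 < ξ) (h1 : ξ ≤ 1) :
    TwoFunctionHypercontractive (1 + ξ) (signPair ξ) := by
  intro f g _ _ hf hg
  have hf' : ∀ x, f x = ENNReal.ofReal (f x).toReal := fun x =>
    (ENNReal.ofReal_toReal (ne_top_of_le_ne_top ENNReal.one_ne_top (hf x))).symm
  have hg' : ∀ x, g x = ENNReal.ofReal (g x).toReal := fun x =>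
    (ENNReal.ofReal_toReal (ne_top_of_le_ne_top ENNReal.one_ne_top (hg x))).symm
  simp only [lintegral_signPair]
  rw [hf' 1, hf' (-1), hg' 1, hg' (-1)]
  have ha : 0 ≤ (f 1).toReal := ENNReal.toReal_nonneg
  have hb : 0 ≤ (f (-1)).toReal := ENNReal.toReal_nonneg
  have hc : 0 ≤ (g 1).toReal := ENNReal.toReal_nonneg
  have hd : 0 ≤ (g (-1)).toReal := ENNReal.toReal_nonneg
  have key := twoPoint_inequality h0 h1 ha hb hc hd
  generalize (f 1).toReal = a at *
  generalize (f (-1)).toReal = b at *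
  generalize (g 1).toReal = c at *
  generalize (g (-1)).toReal = d at *
  have hp : 0 ≤ 1 + ξ := by linarith
  have hm : 0 ≤ 1 - ξ := by linarith
  have hp' : 0 ≤ 1 / (1 + ξ) := by positivity
  simp only [ENNReal.ofReal_rpow_of_nonneg ha hp, ENNReal.ofReal_rpow_of_nonneg hb hp,
    ENNReal.ofReal_rpow_of_nonneg hc hp, ENNReal.ofReal_rpow_of_nonneg hd hp]
  have pa := Real.rpow_nonneg ha (1 + ξ)
  have pb := Real.rpow_nonneg hb (1 + ξ)
  have pc := Real.rpow_nonneg hc (1 + ξ)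
  have pd := Real.rpow_nonneg hd (1 + ξ)
  rw [← ENNReal.ofReal_mul ha, ← ENNReal.ofReal_mul hb, ← ENNReal.ofReal_mul ha,
    ← ENNReal.ofReal_mul hb, ← ENNReal.ofReal_add (by positivity) (by positivity),
    ← ENNReal.ofReal_add (by positivity) (by positivity), ← ENNReal.ofReal_mul (by positivity),
    ← ENNReal.ofReal_mul (by positivity), ← ENNReal.ofReal_add (by positivity) (by positivity),
    ← ENNReal.ofReal_add pa pb, ← ENNReal.ofReal_add pc pd, ← ENNReal.ofReal_add pd pc,
    ← ENNReal.ofReal_mul (by positivity), ← ENNReal.ofReal_mul (by positivity),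
    ← ENNReal.ofReal_mul (by positivity), ← ENNReal.ofReal_mul (by positivity),
    ← ENNReal.ofReal_add (by positivity) (by positivity),
    ← ENNReal.ofReal_add (by positivity) (by positivity),
    ENNReal.ofReal_rpow_of_nonneg (by positivity) hp',
    ENNReal.ofReal_rpow_of_nonneg (by positivity) hp', ← ENNReal.ofReal_mul (by positivity)]
  refine ENNReal.ofReal_le_ofReal ?_
  convert key using 3 <;> ring

/-! ### Weak limits -/

/-- Bounded continuous functions are dense in `L¹`; a subsequence converges almost everywhere, and
clamping to `[0, 1]` does not change the limit. -/
theorem exists_continuous_tendsto_ae {X : Type*} [TopologicalSpace X]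
    [TopologicalSpace.PseudoMetrizableSpace X] [MeasurableSpace X] [BorelSpace X] (μ : Measure X)
    [IsFiniteMeasure μ] {f : X → ℝ≥0∞} (hf : Measurable f) (hf1 : ∀ x, f x ≤ 1) :
    ∃ F : ℕ → X → ℝ≥0, (∀ k, Continuous (F k)) ∧ (∀ k x, F k x ≤ 1) ∧
      ∀ᵐ x ∂μ, Tendsto (fun k => (F k x : ℝ≥0∞)) atTop (𝓝 (f x)) := by
  let := TopologicalSpace.pseudoMetrizableSpacePseudoMetric X
  have htop : ∀ x, f x ≠ ∞ := fun x => ne_top_of_le_ne_top ENNReal.one_ne_top (hf1 x)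
  have hle : ∀ x, (f x).toReal ≤ 1 := fun x => ENNReal.toReal_le_of_le_ofReal zero_le_one
    (by simpa using hf1 x)
  have hmem : MemLp (fun x => (f x).toReal) 1 μ :=
    MemLp.of_bound hf.ennreal_toReal.aestronglyMeasurable 1
      (ae_of_all _ fun x => by simpa [abs_of_nonneg] using hle x)
  have hex : ∀ k : ℕ, ∃ g : X →ᵇ ℝ, eLpNorm ((fun x => (f x).toReal) - (g : X → ℝ)) 1 μ
      ≤ ((k : ℝ≥0∞) + 1)⁻¹ := fun k => by
    obtain ⟨g, hg, -⟩ := hmem.exists_boundedContinuous_eLpNorm_sub_le ENNReal.one_ne_top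
      (ε := ((k : ℝ≥0∞) + 1)⁻¹) (by simp)
    exact ⟨g, hg⟩
  choose g hg using hex
  have hlim : Tendsto (fun k => eLpNorm ((g k : X → ℝ) - fun x => (f x).toReal) 1 μ) atTop (𝓝 0) := by
    refine tendsto_of_tendsto_of_tendsto_of_le_of_le tendsto_const_nhds
      ENNReal.tendsto_inv_nat_nhds_zero (fun _ => zero_le) (fun k => ?_)
    rw [eLpNorm_sub_comm]
    exact (hg k).trans (ENNReal.inv_le_inv.2 le_self_add)
  obtain ⟨ns, -, hns⟩ := (tendstoInMeasure_of_tendsto_eLpNorm one_ne_zero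
    (fun k => (g k).continuous.aestronglyMeasurable) hmem.1 hlim).exists_seq_tendsto_ae
  refine ⟨fun k x => min (g (ns k) x).toNNReal 1, fun k => ?_, fun k x => min_le_right _ _, ?_⟩
  · have := (g (ns k)).continuous
    fun_prop
  · filter_upwards [hns] with x hx
    have h1 : Tendsto (fun k => min (g (ns k) x).toNNReal 1) atTop
        (𝓝 (min (f x).toReal.toNNReal 1)) :=
      ((continuous_real_toNNReal.tendsto _).comp hx).min tendsto_const_nhds
    have h2 : ((min (f x).toReal.toNNReal 1 : ℝ≥0) : ℝ≥0∞) = f x := by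
      rw [min_eq_left (Real.toNNReal_le_one.2 (hle x))]
      exact ENNReal.ofReal_toReal (htop x)
    rw [← h2]
    exact ENNReal.tendsto_coe.2 h1

theorem tendsto_lintegral_of_tendsto_of_le_one {Z : Type*} [TopologicalSpace Z] [MeasurableSpace Z]
    [OpensMeasurableSpace Z] {ν : ℕ → ProbabilityMeasure Z} {ν' : ProbabilityMeasure Z}
    (h : Tendsto ν atTop (𝓝 ν')) {F : Z → ℝ≥0} (hF : Continuous F) (hF1 : ∀ z, F z ≤ 1) :
    Tendsto (fun m => ∫⁻ z, F z ∂(ν m : Measure Z)) atTop (𝓝 (∫⁻ z, F z ∂(ν' : Measure Z))) := by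
  refine ProbabilityMeasure.tendsto_iff_forall_lintegral_tendsto.1 h
    (BoundedContinuousFunction.mkOfBound ⟨F, hF⟩ 1 fun x y => ?_)
  rw [NNReal.dist_eq, abs_le]
  have hx : (F x : ℝ) ≤ 1 := hF1 x
  have hy : (F y : ℝ) ≤ 1 := hF1 y
  constructor <;> simp <;> linarith [(F x).coe_nonneg, (F y).coe_nonneg]

theorem ENNReal.tendsto_rpow_mul_rpow {ι : Type*} {l : Filter ι} {u v : ι → ℝ≥0∞} {a b : ℝ≥0∞}
    {s : ℝ} (hs : 0 ≤ s) (hu : Tendsto u l (𝓝 a)) (hv : Tendsto v l (𝓝 b)) (ha : a ≠ ∞)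
    (hb : b ≠ ∞) : Tendsto (fun i => u i ^ s * v i ^ s) l (𝓝 (a ^ s * b ^ s)) :=
  ENNReal.Tendsto.mul (((ENNReal.continuous_rpow_const).tendsto _).comp hu)
    (Or.inr (ENNReal.rpow_ne_top_of_nonneg hs hb))
    (((ENNReal.continuous_rpow_const).tendsto _).comp hv)
    (Or.inr (ENNReal.rpow_ne_top_of_nonneg hs ha))

/-- For continuous `f, g` all three integrals pass to the weak limit. Measurable `f, g` are then
approximated almost everywhere under the marginals of `ν'`, with the constant `1` as dominating
function. -/
theorem TwoFunctionHypercontractive.of_tendsto {X Y : Type*}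
    [TopologicalSpace X] [TopologicalSpace.PseudoMetrizableSpace X] [SecondCountableTopology X]
    [MeasurableSpace X] [BorelSpace X]
    [TopologicalSpace Y] [TopologicalSpace.PseudoMetrizableSpace Y] [SecondCountableTopology Y]
    [MeasurableSpace Y] [BorelSpace Y] {p : ℝ} (hp : 0 < p)
    {ν : ℕ → ProbabilityMeasure (X × Y)} {ν' : ProbabilityMeasure (X × Y)}
    (hν : Tendsto ν atTop (𝓝 ν'))
    (h : ∀ m, TwoFunctionHypercontractive p (ν m : Measure (X × Y))) :
    TwoFunctionHypercontractive p (ν' : Measure (X × Y)) := by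
  have hlt : ∀ F : X × Y → ℝ≥0∞, (∀ z, F z ≤ 1) → ∫⁻ z, F z ^ p ∂(ν' : Measure (X × Y)) ≠ ∞ := by
    intro F hF
    refine ne_top_of_le_ne_top ENNReal.one_ne_top ?_
    calc _ ≤ ∫⁻ _, 1 ∂(ν' : Measure (X × Y)) :=
          lintegral_mono fun z => ENNReal.rpow_le_one (hF z) hp.le
      _ = 1 := by simp
  have hcont : ∀ (f : X → ℝ≥0) (g : Y → ℝ≥0), Continuous f → Continuous g → (∀ x, f x ≤ 1) →
      (∀ y, g y ≤ 1) → ∫⁻ z, (f z.1 : ℝ≥0∞) * g z.2 ∂(ν' : Measure (X × Y)) ≤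
        (∫⁻ z, (f z.1 : ℝ≥0∞) ^ p ∂(ν' : Measure (X × Y))) ^ (1 / p) *
          (∫⁻ z, (g z.2 : ℝ≥0∞) ^ p ∂(ν' : Measure (X × Y))) ^ (1 / p) := by
    intro f g hf hg hf1 hg1
    have t1 := tendsto_lintegral_of_tendsto_of_le_one hν (F := fun z => f z.1 * g z.2)
      (by fun_prop) (fun z => mul_le_one₀ (hf1 _) zero_le (hg1 _))
    have t2 := tendsto_lintegral_of_tendsto_of_le_one hν (F := fun z => f z.1 ^ p)
      ((NNReal.continuous_rpow_const hp.le).comp (by fun_prop))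
      (fun z => NNReal.rpow_le_one (hf1 _) hp.le)
    have t3 := tendsto_lintegral_of_tendsto_of_le_one hν (F := fun z => g z.2 ^ p)
      ((NNReal.continuous_rpow_const hp.le).comp (by fun_prop))
      (fun z => NNReal.rpow_le_one (hg1 _) hp.le)
    simp only [ENNReal.coe_mul, ENNReal.coe_rpow_of_nonneg _ hp.le] at t1 t2 t3
    refine le_of_tendsto_of_tendsto' t1 (ENNReal.tendsto_rpow_mul_rpow (by positivity) t2 t3
      (hlt (fun z => f z.1) fun z => by exact_mod_cast hf1 _)
      (hlt (fun z => g z.2) fun z => by exact_mod_cast hg1 _)) fun m => ?_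
    exact h m (fun x => f x) (fun y => g y) (by fun_prop) (by fun_prop)
      (fun x => by exact_mod_cast hf1 x) (fun y => by exact_mod_cast hg1 y)
  intro f g hf hg hf1 hg1
  obtain ⟨F, hFc, hF1, hF⟩ :=
    exists_continuous_tendsto_ae ((ν' : Measure (X × Y)).map Prod.fst) hf hf1
  obtain ⟨G, hGc, hG1, hG⟩ :=
    exists_continuous_tendsto_ae ((ν' : Measure (X × Y)).map Prod.snd) hg hg1
  replace hF := ae_of_ae_map measurable_fst.aemeasurable hF
  replace hG := ae_of_ae_map measurable_snd.aemeasurable hG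
  have hF1' : ∀ k x, (F k x : ℝ≥0∞) ≤ 1 := fun k x => by exact_mod_cast hF1 k x
  have hG1' : ∀ k x, (G k x : ℝ≥0∞) ≤ 1 := fun k x => by exact_mod_cast hG1 k x
  have hone : ∫⁻ _ : X × Y, 1 ∂(ν' : Measure (X × Y)) ≠ ∞ := by simp
  have t1 : Tendsto (fun k => ∫⁻ z, (F k z.1 : ℝ≥0∞) * G k z.2 ∂(ν' : Measure (X × Y))) atTop
      (𝓝 (∫⁻ z, f z.1 * g z.2 ∂(ν' : Measure (X × Y)))) := by
    refine tendsto_lintegral_of_dominated_convergence (fun _ => 1) (fun k => ?_)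
      (fun k => ae_of_all _ fun z => mul_le_one₀ (hF1' k _) zero_le (hG1' k _)) hone ?_
    · have := hFc k
      have := hGc k
      fun_prop
    · filter_upwards [hF, hG] with z h1 h2
      exact ENNReal.Tendsto.mul h1 (Or.inr (ne_top_of_le_ne_top ENNReal.one_ne_top (hg1 _))) h2
        (Or.inr (ne_top_of_le_ne_top ENNReal.one_ne_top (hf1 _)))
  have t2 : Tendsto (fun k => ∫⁻ z, (F k z.1 : ℝ≥0∞) ^ p ∂(ν' : Measure (X × Y))) atTop
      (𝓝 (∫⁻ z, f z.1 ^ p ∂(ν' : Measure (X × Y)))) := by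
    refine tendsto_lintegral_of_dominated_convergence (fun _ => 1) (fun k => ?_)
      (fun k => ae_of_all _ fun z => ENNReal.rpow_le_one (hF1' k _) hp.le) hone ?_
    · have := hFc k
      fun_prop
    · filter_upwards [hF] with z h1
      exact (ENNReal.continuous_rpow_const.tendsto _).comp h1
  have t3 : Tendsto (fun k => ∫⁻ z, (G k z.2 : ℝ≥0∞) ^ p ∂(ν' : Measure (X × Y))) atTop
      (𝓝 (∫⁻ z, g z.2 ^ p ∂(ν' : Measure (X × Y)))) := by
    refine tendsto_lintegral_of_dominated_convergence (fun _ => 1) (fun k => ?_)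
      (fun k => ae_of_all _ fun z => ENNReal.rpow_le_one (hG1' k _) hp.le) hone ?_
    · have := hGc k
      fun_prop
    · filter_upwards [hG] with z h1
      exact (ENNReal.continuous_rpow_const.tendsto _).comp h1
  exact le_of_tendsto_of_tendsto' t1 (ENNReal.tendsto_rpow_mul_rpow (by positivity) t2 t3
    (hlt (fun z => f z.1) fun z => hf1 _) (hlt (fun z => g z.2) fun z => hg1 _))
    fun k => hcont (F k) (G k) (hFc k) (hGc k) (hF1 k) (hG1 k)

/-! ### The bivariate central limit theorem for correlated signs -/

theorem posSemidef_correlation {ρ : ℝ} (h1 : -1 ≤ ρ) (h2 : ρ ≤ 1) :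
    (!![1, ρ; ρ, 1] : Matrix (Fin 2) (Fin 2) ℝ).PosSemidef := by
  refine Matrix.PosSemidef.of_dotProduct_mulVec_nonneg ?_ fun x => ?_
  · ext i j
    fin_cases i <;> fin_cases j <;> simp
  · simp [Matrix.mulVec, dotProduct, Fin.sum_univ_two]
    nlinarith [mul_nonneg (sub_nonneg.2 h2) (sq_nonneg (x 0 - x 1)),
      mul_nonneg (by linarith : 0 ≤ 1 + ρ) (sq_nonneg (x 0 + x 1))]

/-- The combination `a x + b y` is centred with variance `q = a ^ 2 + 2 ξ a b + b ^ 2`. Dividing by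
`√q` permits the one-dimensional central limit theorem, evaluated at `√q`. When `q = 0`, `|ξ| < 1`
forces `a = b = 0`. -/
theorem tendsto_charFun_signPair {ξ : ℝ} (h1 : -1 < ξ) (h2 : ξ < 1) (a b : ℝ) :
    Tendsto (fun m : ℕ => charFun ((signPair ξ).map fun z => a * z.1 + b * z.2) (√m)⁻¹ ^ m) atTop
      (𝓝 (Complex.exp (-((a ^ 2 + 2 * ξ * a * b + b ^ 2 : ℝ) : ℂ) / 2))) := by
  have := isProbabilityMeasure_signPair h1.le h2.le
  set q := a ^ 2 + 2 * ξ * a * b + b ^ 2 with hq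
  have hq' : 2 * q = (1 + ξ) * (a + b) ^ 2 + (1 - ξ) * (a - b) ^ 2 := by rw [hq]; ring
  have hq0 : 0 ≤ q := by
    nlinarith [mul_nonneg (by linarith : 0 ≤ 1 + ξ) (sq_nonneg (a + b)),
      mul_nonneg (by linarith : 0 ≤ 1 - ξ) (sq_nonneg (a - b))]
  rcases eq_or_lt_of_le hq0 with h0 | h0
  · have e1 : (a + b) ^ 2 = 0 := by
      nlinarith [mul_nonneg (by linarith : 0 ≤ 1 - ξ) (sq_nonneg (a - b)), sq_nonneg (a + b)]
    have e2 : (a - b) ^ 2 = 0 := by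
      nlinarith [mul_nonneg (by linarith : 0 ≤ 1 + ξ) (sq_nonneg (a + b)), sq_nonneg (a - b)]
    have ha : a = 0 := by nlinarith
    have hb : b = 0 := by nlinarith
    rw [← h0, ha, hb]
    simp
  have hs : √q ≠ 0 := (Real.sqrt_pos.2 h0).ne'
  have key := tendsto_charFun_inv_sqrt_mul_pow (P := signPair ξ)
    (X := fun z => (√q)⁻¹ * (a * z.1 + b * z.2)) (by fun_prop)
    (by rw [integral_signPair h1.le h2.le]; ring)
    (by
      simp only [Pi.pow_apply]
      rw [integral_signPair h1.le h2.le]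
      simp only [mul_pow, inv_pow, Real.sq_sqrt hq0]
      field_simp
      rw [hq]; ring) √q
  convert key using 2 with m
  · rw [charFun_map_mul_comp (by fun_prop)]
    congr 2
    field_simp
  · norm_cast
    rw [Real.sq_sqrt hq0]

/-- The law of the normalized sum of `m` independent pairs of correlated signs. -/
noncomputable def normalizedSignSum (ξ : ℝ) (m : ℕ) : Measure (ℝ × ℝ) :=
  ((Measure.pi fun _ : Fin m => signPair ξ).map
    fun z => ((fun i => (z i).1, fun i => (z i).2) : (Fin m → ℝ) × (Fin m → ℝ))).map
    (Prod.map (fun x => (√m)⁻¹ * ∑ i, x i) (fun y => (√m)⁻¹ * ∑ i, y i))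

theorem charFun_normalizedSignSum {ξ : ℝ} (h1 : -1 ≤ ξ) (h2 : ξ ≤ 1) (m : ℕ)
    (t : EuclideanSpace ℝ (Fin 2)) :
    charFun ((normalizedSignSum ξ m).map fun z => !₂[z.1, z.2]) t =
      charFun ((signPair ξ).map fun z => t 0 * z.1 + t 1 * z.2) (√m)⁻¹ ^ m := by
  have := isProbabilityMeasure_signPair h1 h2
  have hW : Measurable fun z : ℝ × ℝ => (!₂[z.1, z.2] : EuclideanSpace ℝ (Fin 2)) := by fun_prop
  rw [normalizedSignSum, Measure.map_map (by fun_prop) (by fun_prop),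
    Measure.map_map (by fun_prop) (by fun_prop)]
  have e : ((fun z : ℝ × ℝ => (!₂[z.1, z.2] : EuclideanSpace ℝ (Fin 2))) ∘
      Prod.map (fun x => (√m)⁻¹ * ∑ i, x i) (fun y => (√m)⁻¹ * ∑ i, y i)) ∘
      (fun z : Fin m → ℝ × ℝ => ((fun i => (z i).1, fun i => (z i).2) :
        (Fin m → ℝ) × (Fin m → ℝ))) =
      fun z => (√m)⁻¹ • ∑ i, (!₂[(z i).1, (z i).2] : EuclideanSpace ℝ (Fin 2)) := by
    funext z
    ext j
    fin_cases j <;> simp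
  rw [e, charFun_map_smul_comp (by fun_prop), iIndepFun.charFun_map_fun_sum_eq_prod
    (X := fun i (z : Fin m → ℝ × ℝ) => (!₂[(z i).1, (z i).2] : EuclideanSpace ℝ (Fin 2)))
    (fun i => by fun_prop) (iIndepFun_pi (X := fun _ (z : ℝ × ℝ) =>
      (!₂[z.1, z.2] : EuclideanSpace ℝ (Fin 2))) (fun i => hW.aemeasurable))]
  have e2 : ∀ i, (Measure.pi fun _ : Fin m => signPair ξ).map
      (fun z => (!₂[(z i).1, (z i).2] : EuclideanSpace ℝ (Fin 2))) =
      (signPair ξ).map fun z => !₂[z.1, z.2] := by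
    intro i
    conv_rhs => rw [← (measurePreserving_eval (fun _ : Fin m => signPair ξ) i).map_eq]
    rw [Measure.map_map hW (by fun_prop)]
    rfl
  simp only [e2, Finset.prod_const, Finset.card_univ, Fintype.card_fin, Pi.pow_apply]
  congr 1
  rw [charFun_apply, charFun_apply, integral_map (by fun_prop) (by fun_prop),
    integral_map (by fun_prop) (by fun_prop)]
  congr 1
  funext z
  congr 2
  simp [PiLp.inner_apply, Fin.sum_univ_two]
  ring

theorem twoFunctionHypercontractive_gaussianPair {ξ : ℝ} (h0 : 0 < ξ) (h1 : ξ < 1) :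
    TwoFunctionHypercontractive (1 + ξ) (gaussianPair ξ) := by
  have := isProbabilityMeasure_signPair (by linarith : -1 ≤ ξ) h1.le
  have hprob : ∀ m, IsProbabilityMeasure (normalizedSignSum ξ m) := fun m => by
    have : IsProbabilityMeasure ((Measure.pi fun _ : Fin m => signPair ξ).map
      fun z => ((fun i => (z i).1, fun i => (z i).2) : (Fin m → ℝ) × (Fin m → ℝ))) :=
        Measure.isProbabilityMeasure_map (by fun_prop)
    exact Measure.isProbabilityMeasure_map (by fun_prop)
  have hW : Measurable fun z : ℝ × ℝ => (!₂[z.1, z.2] : EuclideanSpace ℝ (Fin 2)) := by fun_prop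
  have hV : Continuous fun z : EuclideanSpace ℝ (Fin 2) => (z 0, z 1) := by fun_prop
  let ν : ℕ → ProbabilityMeasure (ℝ × ℝ) := fun m => ⟨normalizedSignSum ξ m, hprob m⟩
  let G : ProbabilityMeasure (EuclideanSpace ℝ (Fin 2)) :=
    ⟨multivariateGaussian 0 !![1, ξ; ξ, 1], inferInstance⟩
  -- Convergence is proved in `EuclideanSpace`, where Lévy's continuity theorem and the Gaussian
  -- characteristic function apply, and then mapped back to `ℝ × ℝ`.
  have hlim : Tendsto (fun m => (ν m).map hW.aemeasurable) atTop (𝓝 G) := by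
    refine ProbabilityMeasure.tendsto_of_tendsto_charFun fun t => ?_
    have := tendsto_charFun_signPair (by linarith : -1 < ξ) h1 (t 0) (t 1)
    convert this using 2
    · exact charFun_normalizedSignSum (by linarith) h1.le _ t
    · rw [show ((G : Measure (EuclideanSpace ℝ (Fin 2)))) =
        multivariateGaussian 0 !![1, ξ; ξ, 1] from rfl,
        charFun_multivariateGaussian (posSemidef_correlation (by linarith) h1.le)]
      congr 1
      simp [Matrix.mulVec, dotProduct, Fin.sum_univ_two]
      ring
  have hlim2 := ProbabilityMeasure.tendsto_map_of_tendsto_of_continuous _ _ hlim hV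
  refine TwoFunctionHypercontractive.of_tendsto (by linarith) hlim2 fun m => ?_
  have e : ((((ν m).map hW.aemeasurable).map hV.measurable.aemeasurable :
      ProbabilityMeasure (ℝ × ℝ)) : Measure (ℝ × ℝ)) = normalizedSignSum ξ m := by
    change ((normalizedSignSum ξ m).map _).map _ = _
    rw [Measure.map_map hV.measurable hW]
    exact Measure.map_id
  rw [e]
  -- Each normalized sum uses one player's signs only, so the tensorized inequality survives the
  -- pushforward.
  exact ((twoFunctionHypercontractive_signPair h0 h1.le).pi (by linarith) m).map (by fun_prop)
    (by fun_prop)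

/-! ### Gaussian inputs -/

instance isProbabilityMeasure_gaussianPair (ρ : ℝ) : IsProbabilityMeasure (gaussianPair ρ) :=
  Measure.isProbabilityMeasure_map (by fun_prop)

instance isProbabilityMeasure_gaussianInputs (n : ℕ) (ρ : ℝ) :
    IsProbabilityMeasure (gaussianInputs n ρ) :=
  Measure.isProbabilityMeasure_map (by fun_prop)

theorem gaussianPair_map_fst {ρ : ℝ} (h1 : -1 ≤ ρ) (h2 : ρ ≤ 1) :
    (gaussianPair ρ).map Prod.fst = gaussianReal 0 1 := by
  rw [gaussianPair, Measure.map_map (by fun_prop) (by fun_prop)]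
  have := (measurePreserving_eval_multivariateGaussian (μ := 0) (posSemidef_correlation h1 h2)
    (i := 0)).map_eq
  simpa [Function.comp_def] using this

theorem gaussianPair_map_snd {ρ : ℝ} (h1 : -1 ≤ ρ) (h2 : ρ ≤ 1) :
    (gaussianPair ρ).map Prod.snd = gaussianReal 0 1 := by
  rw [gaussianPair, Measure.map_map (by fun_prop) (by fun_prop)]
  have := (measurePreserving_eval_multivariateGaussian (μ := 0) (posSemidef_correlation h1 h2)
    (i := 1)).map_eq
  simpa [Function.comp_def] using this

theorem gaussianPair_zero : gaussianPair 0 = (gaussianReal 0 1).prod (gaussianReal 0 1) := by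
  rw [gaussianPair, show (!![1, 0; 0, 1] : Matrix (Fin 2) (Fin 2) ℝ) = 1 from
    Matrix.one_fin_two.symm, multivariateGaussian_zero_one, ← map_pi_eq_stdGaussian,
    Measure.map_map (by fun_prop) (by fun_prop)]
  exact (measurePreserving_finTwoArrow (gaussianReal 0 1)).map_eq

theorem gaussianInputs_map_fst {ρ : ℝ} (h1 : -1 ≤ ρ) (h2 : ρ ≤ 1) (n : ℕ) :
    (gaussianInputs n ρ).map Prod.fst = Measure.pi fun _ => gaussianReal 0 1 := by
  have : ∀ _ : Fin n, SigmaFinite ((gaussianPair ρ).map Prod.fst) := fun _ => by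
    rw [gaussianPair_map_fst h1 h2]; infer_instance
  rw [gaussianInputs, Measure.map_map (by fun_prop) (by fun_prop)]
  have h := Measure.pi_map_pi (μ := fun _ : Fin n => gaussianPair ρ) (f := fun _ => Prod.fst)
    (fun _ => measurable_fst.aemeasurable)
  simp only [gaussianPair_map_fst h1 h2] at h
  exact h

theorem gaussianInputs_map_snd {ρ : ℝ} (h1 : -1 ≤ ρ) (h2 : ρ ≤ 1) (n : ℕ) :
    (gaussianInputs n ρ).map Prod.snd = Measure.pi fun _ => gaussianReal 0 1 := by
  have : ∀ _ : Fin n, SigmaFinite ((gaussianPair ρ).map Prod.snd) := fun _ => by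
    rw [gaussianPair_map_snd h1 h2]; infer_instance
  rw [gaussianInputs, Measure.map_map (by fun_prop) (by fun_prop)]
  have h := Measure.pi_map_pi (μ := fun _ : Fin n => gaussianPair ρ) (f := fun _ => Prod.snd)
    (fun _ => measurable_snd.aemeasurable)
  simp only [gaussianPair_map_snd h1 h2] at h
  exact h

theorem gaussianInputs_zero (n : ℕ) : gaussianInputs n 0 =
    (Measure.pi fun _ => gaussianReal 0 1).prod (Measure.pi fun _ => gaussianReal 0 1) := by
  rw [gaussianInputs, gaussianPair_zero]
  exact (measurePreserving_arrowProdEquivProdArrow ℝ ℝ (Fin n) (fun _ => gaussianReal 0 1)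
    (fun _ => gaussianReal 0 1)).map_eq

/-- The marginals do not depend on the correlation, so the product of marginal masses given by
hypercontractivity is the mass of the rectangle at correlation `0`. -/
theorem gaussianInputs_prod_le {ξ : ℝ} (h0 : 0 < ξ) (h1 : ξ < 1) (n : ℕ) {A B : Set (Fin n → ℝ)}
    (hA : MeasurableSet A) (hB : MeasurableSet B) :
    gaussianInputs n ξ (A ×ˢ B) ≤ gaussianInputs n 0 (A ×ˢ B) ^ (1 / (1 + ξ)) := by
  have hp : 0 < 1 + ξ := by linarith
  have h := ((twoFunctionHypercontractive_gaussianPair h0 h1).pi hp n).measure_prod_le hp hA hB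
  rw [← gaussianInputs, gaussianInputs_map_fst (by linarith) h1.le,
    gaussianInputs_map_snd (by linarith) h1.le] at h
  rwa [gaussianInputs_zero, Measure.prod_prod]

/-! ### Protocol trees -/

/-- Convexity of `t ↦ t ^ (1 / s)` at the points `a ^ s` and `b ^ s`. This is the price of one bit.
-/
theorem ENNReal.rpow_add_rpow_le_two_rpow_mul {s : ℝ} (h0 : 0 < s) (h1 : s ≤ 1) (a b : ℝ≥0∞) :
    a ^ s + b ^ s ≤ 2 ^ (1 - s) * (a + b) ^ s := by
  have h := ENNReal.rpow_add_le_mul_rpow_add_rpow (a ^ s) (b ^ s) (p := 1 / s)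
    ((one_le_div h0).2 h1)
  have h' := ENNReal.rpow_le_rpow h h0.le
  rw [ENNReal.mul_rpow_of_nonneg _ _ h0.le] at h'
  simp only [← ENNReal.rpow_mul] at h'
  rw [one_div_mul_cancel h0.ne', mul_one_div_cancel h0.ne',
    show (1 / s - 1) * s = 1 - s by field_simp] at h'
  simpa using h'

/-- Messages need not be measurable, so a tree's own rectangles may not be either. With finitely
many distinct rows and columns, each set of inputs sharing a row is a finite intersection of
measurable sections. Picking one representative per such set gives a `φ` under which every set,
measurable or not, has measurable preimage. -/
theorem exists_measurable_representative {X Y : Type*} [MeasurableSpace X] {h : X → Y → Bool}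
    (hm : ∀ y, Measurable fun x => h x y) (hr : (Set.range h).Finite)
    (hc : (Set.range fun y x => h x y).Finite) :
    ∃ φ : X → X, (∀ A : Set X, MeasurableSet (φ ⁻¹' A)) ∧ ∀ x, h (φ x) = h x := by
  have := hr.to_subtype
  have := hc.to_subtype
  have hfib : ∀ r : Set.range h, MeasurableSet {x | h x = r} := by
    rintro ⟨_, x₀, rfl⟩
    have e : {x | h x = h x₀} = ⋂ c : Set.range fun y x => h x y,
        {x | h x (Set.rangeSplitting (fun y x => h x y) c) =
          h x₀ (Set.rangeSplitting (fun y x => h x y) c)} := by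
      ext x
      simp only [Set.mem_ofPred_eq, Set.mem_iInter]
      refine ⟨fun hx c => by rw [hx], fun hx => funext fun y => ?_⟩
      have hy := Set.apply_rangeSplitting (fun y x => h x y) ⟨_, y, rfl⟩
      have h1 := congrFun hy x
      have h2 := congrFun hy x₀
      simp only at h1 h2
      rw [← h1, ← h2]
      exact hx _
    change MeasurableSet {x | h x = h x₀}
    rw [e]
    exact MeasurableSet.iInter fun c => hm _ (measurableSet_singleton _)
  refine ⟨fun x => Set.rangeSplitting h ⟨h x, x, rfl⟩, fun A => ?_, fun x =>
    Set.apply_rangeSplitting h ⟨h x, x, rfl⟩⟩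
  have e : (fun x => Set.rangeSplitting h ⟨h x, x, rfl⟩) ⁻¹' A =
      ⋃ (r : Set.range h) (_ : Set.rangeSplitting h r ∈ A), {x | h x = r} := by
    ext x
    simp only [Set.mem_preimage, Set.mem_iUnion, Set.mem_ofPred_eq, exists_prop]
    constructor
    · exact fun hx => ⟨⟨h x, x, rfl⟩, hx, rfl⟩
    · rintro ⟨r, hr, hx⟩
      have : r = ⟨h x, x, rfl⟩ := Subtype.ext hx.symm
      rwa [← this]
  rw [e]
  exact MeasurableSet.iUnion fun r => MeasurableSet.iUnion fun _ => hfib r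

namespace ProtocolTree

variable {X Y : Type*}

/-- At Alice's node a row is a row of one child; at Bob's node it is determined by a pair of rows,
one from each child. -/
theorem finite_range_run (t : ProtocolTree X Y) : (Set.range t.run).Finite := by
  induction t with
  | output b =>
    refine (Set.finite_singleton fun _ : Y => b).subset ?_
    rintro _ ⟨x, rfl⟩
    rfl
  | alice msg next ih =>
    refine ((ih false).union (ih true)).subset ?_
    rintro _ ⟨x, rfl⟩
    cases hx : msg x
    · exact Or.inl ⟨x, by funext y; simp [run, hx]⟩
    · exact Or.inr ⟨x, by funext y; simp [run, hx]⟩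
  | bob msg next ih =>
    refine ((ih false).image2 (fun r r' y => if msg y then r' y else r y) (ih true)).subset ?_
    rintro _ ⟨x, rfl⟩
    refine ⟨_, ⟨x, rfl⟩, _, ⟨x, rfl⟩, ?_⟩
    funext y
    cases hy : msg y <;> simp [run, hy]

theorem finite_range_run_swap (t : ProtocolTree X Y) :
    (Set.range fun y x => t.run x y).Finite := by
  induction t with
  | output b =>
    refine (Set.finite_singleton fun _ : X => b).subset ?_
    rintro _ ⟨x, rfl⟩
    rfl
  | bob msg next ih =>
    refine ((ih false).union (ih true)).subset ?_
    rintro _ ⟨y, rfl⟩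
    cases hy : msg y
    · exact Or.inl ⟨y, by funext x; simp [run, hy]⟩
    · exact Or.inr ⟨y, by funext x; simp [run, hy]⟩
  | alice msg next ih =>
    refine ((ih false).image2 (fun r r' x => if msg x then r' x else r x) (ih true)).subset ?_
    rintro _ ⟨y, rfl⟩
    refine ⟨_, ⟨y, rfl⟩, _, ⟨y, rfl⟩, ?_⟩
    funext x
    cases hx : msg x <;> simp [run, hx]

variable [MeasurableSpace X] [MeasurableSpace Y] {ν μ : Measure (X × Y)} {s : ℝ}

/-- One splitting step: bounds with `d` bits on both parts of a measurable partition give a bound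
with `d + 1` bits. -/
theorem measure_le_of_split (h0 : 0 < s) (h1 : s ≤ 1) {E S : Set (X × Y)} (hS : MeasurableSet S)
    {d₀ d₁ : ℕ} (hin : ν (E ∩ S) ≤ 2 ^ ((1 - s) * d₁) * μ (E ∩ S) ^ s)
    (hout : ν (E \ S) ≤ 2 ^ ((1 - s) * d₀) * μ (E \ S) ^ s) :
    ν E ≤ 2 ^ ((1 - s) * (max d₀ d₁ + 1 : ℕ)) * μ E ^ s := by
  have hs : 0 ≤ 1 - s := by linarith
  have hle : ∀ {d : ℕ}, d ≤ max d₀ d₁ →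
      (2 : ℝ≥0∞) ^ ((1 - s) * d) ≤ 2 ^ ((1 - s) * (max d₀ d₁ : ℕ)) := fun hd =>
    ENNReal.rpow_le_rpow_of_exponent_le one_le_two
      (mul_le_mul_of_nonneg_left (Nat.cast_le.2 hd) hs)
  rw [← measure_inter_add_sdiff E hS, ← measure_inter_add_sdiff (μ := μ) E hS]
  calc ν (E ∩ S) + ν (E \ S)
      ≤ 2 ^ ((1 - s) * (max d₀ d₁ : ℕ)) * μ (E ∩ S) ^ s +
          2 ^ ((1 - s) * (max d₀ d₁ : ℕ)) * μ (E \ S) ^ s := by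
        gcongr ?_ + ?_
        · exact hin.trans (mul_le_mul_left (hle (le_max_right _ _)) _)
        · exact hout.trans (mul_le_mul_left (hle (le_max_left _ _)) _)
    _ ≤ 2 ^ ((1 - s) * (max d₀ d₁ : ℕ)) * (2 ^ (1 - s) * (μ (E ∩ S) + μ (E \ S)) ^ s) := by
        rw [← mul_add]
        gcongr
        exact ENNReal.rpow_add_rpow_le_two_rpow_mul h0 h1 _ _
    _ = _ := by
        rw [← mul_assoc, ← ENNReal.rpow_add _ _ two_ne_zero ENNReal.ofNat_ne_top]
        congr 3
        push_cast
        ring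

/-- Precomposing with `U` and `V` makes every rectangle measurable. `A` and `B` vary in the
induction because each message shrinks one of them; at a leaf the event is a rectangle or empty. -/
theorem measure_run_le_aux (h0 : 0 < s) (h1 : s ≤ 1)
    (hrect : ∀ (A : Set X) (B : Set Y), MeasurableSet A → MeasurableSet B →
      ν (A ×ˢ B) ≤ μ (A ×ˢ B) ^ s)
    {X' Y' : Type*} {U : X → X'} {V : Y → Y'} (hU : ∀ A : Set X', MeasurableSet (U ⁻¹' A))
    (hV : ∀ B : Set Y', MeasurableSet (V ⁻¹' B)) (b : Bool) (t : ProtocolTree X' Y')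
    (A : Set X') (B : Set Y') :
    ν {z | U z.1 ∈ A ∧ V z.2 ∈ B ∧ t.run (U z.1) (V z.2) = b} ≤
      2 ^ ((1 - s) * t.depth) * μ {z | U z.1 ∈ A ∧ V z.2 ∈ B ∧ t.run (U z.1) (V z.2) = b} ^ s := by
  induction t generalizing A B with
  | output b' =>
    by_cases hb : b' = b
    · simpa [run, depth, hb, Set.prod, Set.preimage, SProd.sprod] using
        hrect (U ⁻¹' A) (V ⁻¹' B) (hU A) (hV B)
    · simp [run, hb]
  | alice msg next ih =>
    refine measure_le_of_split h0 h1 (measurable_fst (hU {x | msg x = true})) ?_ ?_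
    · convert ih true (A ∩ {x | msg x = true}) B using 4
      all_goals
        ext z
        cases hz : msg (U z.1) <;> simp [run, hz]
    · convert ih false (A ∩ {x | msg x = false}) B using 4
      all_goals
        ext z
        cases hz : msg (U z.1) <;> simp [run, hz]
  | bob msg next ih =>
    refine measure_le_of_split h0 h1 (measurable_snd (hV {y | msg y = true})) ?_ ?_
    · convert ih true A (B ∩ {y | msg y = true}) using 4
      all_goals
        ext z
        cases hz : msg (V z.2) <;> simp [run, hz]
    · convert ih false A (B ∩ {y | msg y = false}) using 4
      all_goals
        ext z
        cases hz : msg (V z.2) <;> simp [run, hz]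

/-- If `ν ≤ μ ^ s` on measurable rectangles, then the same holds for the event that a protocol tree
outputs `b`, up to a factor `2 ^ ((1 - s) * depth)`. Only the output has to be measurable, not the
messages. -/
theorem measure_run_le (h0 : 0 < s) (h1 : s ≤ 1)
    (hrect : ∀ (A : Set X) (B : Set Y), MeasurableSet A → MeasurableSet B →
      ν (A ×ˢ B) ≤ μ (A ×ˢ B) ^ s)
    (t : ProtocolTree X Y) (ht : Measurable fun z : X × Y => t.run z.1 z.2) (b : Bool) :
    ν {z | t.run z.1 z.2 = b} ≤ 2 ^ ((1 - s) * t.depth) * μ {z | t.run z.1 z.2 = b} ^ s := by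
  obtain ⟨φ, hφ, hφr⟩ := exists_measurable_representative (h := t.run)
    (fun y => ht.comp measurable_prodMk_right) t.finite_range_run t.finite_range_run_swap
  obtain ⟨ψ, hψ, hψr⟩ := exists_measurable_representative (h := fun y x => t.run x y)
    (fun x => ht.comp measurable_prodMk_left) t.finite_range_run_swap t.finite_range_run
  -- `φ` preserves rows and `ψ` preserves columns, so running the tree on representatives leaves the
  -- output unchanged.
  have e : ∀ z : X × Y, t.run (φ z.1) (ψ z.2) = t.run z.1 z.2 := fun z => by
    rw [hφr]
    exact congrFun (hψr z.2) z.1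
  simpa [e] using measure_run_le_aux h0 h1 hrect hφ hψ b t Set.univ Set.univ

theorem run_eq_of_depth_eq_zero {X Y : Type*} {t : ProtocolTree X Y} (h : t.depth = 0) :
    ∃ b, ∀ x y, t.run x y = b := by
  cases t with
  | output b => exact ⟨b, fun _ _ => rfl⟩
  | alice msg next => simp [depth] at h
  | bob msg next => simp [depth] at h

end ProtocolTree

/-! ### The communication lower bound -/

/-- With `s = 1 / (1 + ξ)`, weighted AM-GM gives `b ^ s ≤ b + ξ`, and Bernoulli gives `2 ^ (k ξ) ≤ 1
+ k ξ`. In `(1 + k ξ) (b + ξ) - b` each of the three terms is at most `k ξ`; for the bare `ξ` this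
needs `k ≥ 1`. -/
theorem sub_le_three_mul {ξ a b : ℝ} {k : ℕ} (hξ : 0 < ξ) (hk : 1 ≤ k) (hkξ : k * ξ ≤ 1)
    (hb0 : 0 ≤ b) (hb1 : b ≤ 1)
    (h : a ≤ 2 ^ ((1 - 1 / (1 + ξ)) * k) * b ^ (1 / (1 + ξ))) : a - b ≤ 3 * (k * ξ) := by
  have hk' : (1 : ℝ) ≤ k := by exact_mod_cast hk
  have hs : 1 - 1 / (1 + ξ) ≤ ξ := by
    rw [show 1 - 1 / (1 + ξ) = ξ / (1 + ξ) by field_simp; ring]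
    exact div_le_self hξ.le (by linarith)
  have hs0 : 0 ≤ 1 / (1 + ξ) := by positivity
  have hs1 : 1 / (1 + ξ) ≤ 1 := (div_le_one (by linarith)).2 (by linarith)
  have hb : b ^ (1 / (1 + ξ)) ≤ b + ξ := by
    have := Real.geom_mean_le_arith_mean2_weighted hs0 (sub_nonneg.2 hs1) hb0 zero_le_one
      (add_sub_cancel _ _)
    rw [Real.one_rpow, mul_one] at this
    nlinarith
  have h2 : (2 : ℝ) ^ ((1 - 1 / (1 + ξ)) * k) ≤ 1 + k * ξ := by
    calc (2 : ℝ) ^ ((1 - 1 / (1 + ξ)) * k) ≤ (1 + 1) ^ (k * ξ) := by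
          rw [one_add_one_eq_two]
          exact Real.rpow_le_rpow_of_exponent_le one_le_two (by nlinarith)
      _ ≤ 1 + k * ξ * 1 := rpow_one_add_le_one_add_mul_self (by norm_num) (by positivity) hkξ
      _ = _ := by ring
  have h3 : a ≤ (1 + k * ξ) * (b + ξ) :=
    h.trans (mul_le_mul h2 hb (Real.rpow_nonneg hb0 _) (by positivity))
  nlinarith [mul_nonneg (mul_nonneg (by linarith : (0 : ℝ) ≤ k) hξ.le) (sub_nonneg.2 hb1),
    mul_nonneg hξ.le (sub_nonneg.2 hkξ)]

theorem abs_gaussianInputs_run_sub_le {ξ : ℝ} (hξ : 0 < ξ) (hξ1 : ξ < 1) {n k : ℕ}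
    (hkξ : k * ξ ≤ 1) (t : ProtocolTree (Fin n → ℝ) (Fin n → ℝ)) (hd : t.depth ≤ k)
    (ht : Measurable fun z : (Fin n → ℝ) × (Fin n → ℝ) => t.run z.1 z.2) :
    |(gaussianInputs n ξ).real {z | t.run z.1 z.2 = true} -
      (gaussianInputs n 0).real {z | t.run z.1 z.2 = true}| ≤ 3 * (k * ξ) := by
  -- With no communication the output is constant, so the difference is `0`.
  rcases Nat.eq_zero_or_pos k with hk | hk
  · obtain ⟨b, hb⟩ := ProtocolTree.run_eq_of_depth_eq_zero (t := t) (by omega)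
    cases b <;> simp [hb, hk]
  have hs0 : 0 < 1 / (1 + ξ) := by positivity
  have hs1 : 1 / (1 + ξ) ≤ 1 := (div_le_one (by linarith)).2 (by linarith)
  -- The estimate is one-sided; output `false` supplies the reverse inequality by complementation.
  have key : ∀ b, (gaussianInputs n ξ).real {z | t.run z.1 z.2 = b} -
      (gaussianInputs n 0).real {z | t.run z.1 z.2 = b} ≤ 3 * (k * ξ) := by
    intro b
    refine sub_le_three_mul hξ hk hkξ measureReal_nonneg measureReal_le_one ?_
    have h := t.measure_run_le hs0 hs1
      (fun A B hA hB => gaussianInputs_prod_le hξ hξ1 n hA hB) ht b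
    have h' := ENNReal.toReal_mono (ENNReal.mul_ne_top
      (ENNReal.rpow_ne_top_of_nonneg (mul_nonneg (sub_nonneg.2 hs1) (Nat.cast_nonneg _))
        ENNReal.ofNat_ne_top) (ENNReal.rpow_ne_top_of_nonneg hs0.le (measure_ne_top _ _))) h
    rw [ENNReal.toReal_mul, ← ENNReal.toReal_rpow, ← ENNReal.toReal_rpow, ENNReal.toReal_ofNat]
      at h'
    refine h'.trans ?_
    rw [← Measure.real]
    gcongr
    · exact one_le_two
  have hcompl : ∀ ρ, (gaussianInputs n ρ).real {z | t.run z.1 z.2 = false} =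
      1 - (gaussianInputs n ρ).real {z | t.run z.1 z.2 = true} := by
    intro ρ
    have hS : MeasurableSet {z : (Fin n → ℝ) × (Fin n → ℝ) | t.run z.1 z.2 = true} :=
      ht (measurableSet_singleton true)
    rw [← probReal_compl_eq_one_sub hS]
    congr 1
    ext z
    simp
  have hf := key false
  rw [hcompl, hcompl] at hf
  rw [abs_le]
  exact ⟨by linarith, key true⟩

namespace SharedRandomnessProtocol

variable {X Y Ω : Type*} [MeasurableSpace X] [MeasurableSpace Y] [MeasurableSpace Ω] {k : ℕ}

theorem measurableSet_accept (Q : SharedRandomnessProtocol X Y Ω k) :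
    MeasurableSet {z : (X × Y) × Ω | (Q.tree z.2).run z.1.1 z.1.2 = true} :=
  Q.measurable_run (measurableSet_singleton true)

theorem integrable_accept (Q : SharedRandomnessProtocol X Y Ω k) (P : Measure Ω)
    [IsFiniteMeasure P] (μ : Measure (X × Y)) [IsProbabilityMeasure μ] :
    Integrable (fun ω => μ.real {z | (Q.tree ω).run z.1 z.2 = true}) P :=
  Integrable.of_bound
    (measurable_measure_prodMk_right Q.measurableSet_accept).ennreal_toReal.aestronglyMeasurable 1
    (ae_of_all _ fun ω => by
      rw [Real.norm_of_nonneg measureReal_nonneg]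
      exact measureReal_le_one)

theorem acceptProb_eq_integral (Q : SharedRandomnessProtocol X Y Ω k) (P : Measure Ω)
    [IsFiniteMeasure P] (μ : Measure (X × Y)) [IsProbabilityMeasure μ] :
    Q.acceptProb P μ = ∫ ω, μ.real {z | (Q.tree ω).run z.1 z.2 = true} ∂P := by
  rw [acceptProb, Measure.real, Measure.prod_apply_symm Q.measurableSet_accept]
  exact (integral_toReal (measurable_measure_prodMk_right Q.measurableSet_accept).aemeasurable
    (ae_of_all _ fun ω => measure_lt_top _ _)).symm

theorem advantage_gaussianInputs_le {n : ℕ}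
    (Q : SharedRandomnessProtocol (Fin n → ℝ) (Fin n → ℝ) Ω k) (P : Measure Ω)
    [IsProbabilityMeasure P] {ξ : ℝ} (hξ : 0 < ξ) (hξ1 : ξ < 1) (hkξ : k * ξ ≤ 1) :
    Q.advantage P (gaussianInputs n ξ) (gaussianInputs n 0) ≤ 3 * (k * ξ) := by
  rw [advantage, Q.acceptProb_eq_integral, Q.acceptProb_eq_integral,
    ← integral_sub (Q.integrable_accept P _) (Q.integrable_accept P _), ← Real.norm_eq_abs]
  refine (norm_integral_le_of_norm_le_const (C := 3 * (k * ξ))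
    (ae_of_all _ fun ω => ?_)).trans_eq ?_
  · exact abs_gaussianInputs_run_sub_le hξ hξ1 hkξ (Q.tree ω) (Q.depth_le ω)
      (Q.measurable_run.comp measurable_prodMk_right)
  · simp

end SharedRandomnessProtocol

theorem mainTheorem12 (γ : ℝ) (hγ : 0 < γ) :
    ∃ c : ℝ, 0 < c ∧
      ∀ ξ : ℝ, 0 < ξ → ξ < 1 / 2 →
      ∀ (n k : ℕ) (Ω : Type*) [MeasurableSpace Ω] (P : Measure Ω) [IsProbabilityMeasure P]
        (Q : SharedRandomnessProtocol (Fin n → ℝ) (Fin n → ℝ) Ω k),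
        γ ≤ Q.advantage P (gaussianInputs n ξ) (gaussianInputs n 0) →
        c / ξ ≤ (k : ℝ) := by
  -- If `k ξ < c`, the `1` supplies the hypothesis `k ξ ≤ 1`, and `γ / 3` makes `3 k ξ < γ`.
  refine ⟨min 1 (γ / 3), lt_min one_pos (by positivity), ?_⟩
  intro ξ hξ hξ2 n k Ω _ P _ Q hQ
  rw [div_le_iff₀ hξ]
  by_contra! hlt
  have h1 := hlt.trans_le (min_le_left _ _)
  have h2 := hlt.trans_le (min_le_right _ _)
  have h3 := Q.advantage_gaussianInputs_le P hξ (by linarith) h1.le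
  linarith
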